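/- **Setting.** Let $\mathcal D_0,\dots,\mathcal D_m$ be probability distributions on $\mathcal X\times\mathcal Y$, let $\Theta\subseteq\mathbb R^p$, let $f_\theta:\mathcal X\to\mathcal Y$ be a parametrized family and $\bar\ell_0,\dots,\bar\ell_m:\mathcal Y\times\mathcal Y\to\mathbb R$ losses. Put $\ell_i(\theta)=\mathbb E_{(x,y)\sim\mathcal D_i}[\bar\ell_i(f_\theta(x),y)]$ and, for a data set with $N_i\ge 1$ examples $(x_n,y_n)$ i.i.d. from $\mathcal D_i$ for each $i$ (with any dependence between different $i$), $\hat\ell_i(\theta)=\frac1{N_i}\sum_{n=1}^{N_i}\bar\ell_i(f_\theta(x_n),y_n)$. Let $(P)$ be the problem: minimize $\ell_0$ over $\Theta$ subject to $\ell_1,\dots,\ell_m\le 0$, with optimal value $P^\star$. With $\Psi(x,y)=\frac14\left(\max\{0,2x+y\}^2-y^2\right)$ let $$L(\theta,\lambda,\alpha)=\ell_0(\theta)+\alpha\sum_{i=1}^m\Psi\!\left(\ell_i(\theta),\tfrac{\lambda_i}{\alpha}\right),\qquad g(\lambda,\alpha)=\inf_{\theta\in\Theta}L(\theta,\lambda,\alpha),$$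 and let the augmented dual problem $(D)$ be to maximize $g$ over $(\lambda,\alpha)\in\mathbb R^m\times(0,\infty)$. Let $(\hat P),\hat L,\hat g,(\hat D)$ be the same objects for $\hat\ell_0,\dots,\hat\ell_m$. **Assumptions.** (1) $\ell_0$ is bounded below on $\Theta$. (2) $\Theta$ is closed. (3) $\theta\mapsto f_\theta(x)$ is continuous on $\Theta$ for every $x$; each $\bar\ell_i(\cdot,y)$ is continuous and each $\bar\ell_i$ is bounded. (4) There are $u>0$ and a real $\bar p>P^\star$ for which $\{\theta\in\Theta:\ell_0(\theta)\le\bar p,\ \ell_i(\theta)\le u,\ i=1,\dots,m\}$ is compact. (5) At an optimal point of $(P)$ the gradients of the active constraints are linearly independent. (6) Every $\ell_i$ is $C^2$ around every point of $\Theta$. (7) Some $\bar\lambda\in\mathbb R^m_{\ge0}$ satisfies the KKT conditions at the optimal point $\bar\theta$ of $(P)$: $\nabla\big(\ell_0+\sum_i\bar\lambda_i\ell_i\big)(\bar\theta)=0$ and $\bar\lambda_i\ell_i(\bar\theta)=0$ for all $i$; moreover $z^\top\nabla^2\big(\ell_0+\sum_i\bar\lambda_i\ell_i\big)(\bar\theta)\,z>0$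 for every $z\ne0$ such that, for all active $i$, $\nabla\ell_i(\bar\theta)^\top z=0$ if $\bar\lambda_i>0$ and $\nabla\ell_i(\bar\theta)^\top z\le0$ if $\bar\lambda_i=0$. (If there are several optimal points, one $\bar\lambda$ serves them all.) (8) There are $\zeta_i(N,\delta)\ge0$, nonincreasing in $N$, such that for $N\ge1$, $\delta\in(0,1)$ and $i=0,\dots,m$, with probability at least $1-\delta$ over $N$ i.i.d. samples from $\mathcal D_i$, $|\ell_i(\theta)-\hat\ell_i(\theta)|\le\zeta_i(N,\delta)$ for all $\theta\in\Theta$. **Theorem.** Under (1)-(8), $P^\star$ is finite and attained and $(D)$ has a solution. If, for a given data set, $(\hat P)$ satisfies the analogues of (4)-(7), then $(\hat P)$ and $(\hat D)$ have solutions. Moreover: (a) For every data set for which $(\hat P)$ satisfies the analogue of (4), every solution $(\hat\lambda^\star,\hat\alpha^\star)$ of $(\hat D)$ and every solution $\hat\theta^\star$ of $(\hat P)$ satisfy $\hat\theta^\star\in\arg\min_{\theta\in\Theta}\hat L(\theta,\hat\lambda^\star,\hat\alpha^\star)$. (b) For all sample sizes $N_i\ge1$ and $\delta\in(0,1)$,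 with probability at least $1-(2m+1)\delta$ over the data set: if $(\hat P)$ satisfies the analogue of (4), then for all solutions $\hat\theta^\star$ of $(\hat P)$, $(\hat\lambda^\star,\hat\alpha^\star)$ of $(\hat D)$ and $(\lambda^\star,\alpha^\star)$ of $(D)$, $$|P^\star-\ell_0(\hat\theta^\star)|\le(2+\Delta_\lambda)\bar\zeta+\Delta_\alpha m\bar\zeta^2,\qquad \ell_i(\hat\theta^\star)\le\zeta_i(N_i,\delta)\quad(i=1,\dots,m),$$ where $\bar\zeta=\max_{0\le i\le m}\zeta_i(N_i,\delta)$, $\Delta_\lambda=\max(\|\lambda^\star\|_1,\|\hat\lambda^\star\|_1)$ and $\Delta_\alpha=\max(\alpha^\star,\hat\alpha^\star)$. (c) (PACC learning, without a residual constant.) Suppose that $\zeta_i(N,\delta)\to0$ as $N\to\infty$ for all $i$ and all $\delta\in(0,1)$. Let a learner assign a parameter $\hat\theta^\star$ to every data set, so that for every $\delta\in(0,1)$ there are $B$ and $N_0$ such that, whenever all $N_i\ge N_0$, with probability at least $1-\delta$ the problem $(\hat P)$ satisfies the analogue of (4), $\hat\theta^\star$ is a solution of it, and $(\hat D)$ has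 a solution with $\|\hat\lambda^\star\|_1\le B$ and $\hat\alpha^\star\le B$. Then for all $\varepsilon>0$ and $\delta\in(0,1)$ there is $N_0$ such that, whenever all $N_i\ge N_0$, with probability at least $1-\delta$: $\hat\theta^\star\in\Theta$, $|P^\star-\ell_0(\hat\theta^\star)|\le\varepsilon$ and $\ell_i(\hat\theta^\star)\le\varepsilon$ for $i=1,\dots,m$. -/

import Mathlib

open MeasureTheory Filter Topology

noncomputable section

namespace PACC

/-- The parameter space `ℝ^p`. -/
abbrev Param (p : ℕ) : Type := EuclideanSpace ℝ (Fin p)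

/-! ### Constrained programs and their augmented dual

A program is a family `ℓ 0, ℓ 1, …, ℓ m` of real functions on `ℝ^p` and a set `Θ`: minimize `ℓ 0`
over `Θ` subject to `ℓ 1 ≤ 0, …, ℓ m ≤ 0`. The constraint with index `i : Fin m` is `ℓ i.succ`. -/

variable {p m : ℕ}

/-- The points of `Θ` that satisfy every constraint. -/
def feasibleSet (ℓ : Fin (m + 1) → Param p → ℝ) (Θ : Set (Param p)) : Set (Param p) :=
  {θ | θ ∈ Θ ∧ ∀ i : Fin m, ℓ i.succ θ ≤ 0}

/-- The optimal value of the program (`⊤` if there is no feasible point). -/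
def primalValue (ℓ : Fin (m + 1) → Param p → ℝ) (Θ : Set (Param p)) : EReal :=
  ⨅ θ ∈ feasibleSet ℓ Θ, ((ℓ 0 θ : ℝ) : EReal)

/-- `θ` is a solution (global minimizer) of the program. -/
def IsPrimalSolution (ℓ : Fin (m + 1) → Param p → ℝ) (Θ : Set (Param p)) (θ : Param p) : Prop :=
  θ ∈ feasibleSet ℓ Θ ∧ ∀ θ' ∈ feasibleSet ℓ Θ, ℓ 0 θ ≤ ℓ 0 θ'

/-- `Ψ(x, y) = (max{0, 2x + y}² - y²) / 4`. -/
def Psi (x y : ℝ) : ℝ := ((max 0 (2 * x + y)) ^ 2 - y ^ 2) / 4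

/-- The augmented Lagrangian `L(θ, λ, α)`. -/
def augLagrangian (ℓ : Fin (m + 1) → Param p → ℝ) (θ : Param p) (lam : Fin m → ℝ) (α : ℝ) : ℝ :=
  ℓ 0 θ + α * ∑ i : Fin m, Psi (ℓ i.succ θ) (lam i / α)

/-- The augmented dual function `g(λ, α) = inf_{θ ∈ Θ} L(θ, λ, α)`. -/
def dualFunction (ℓ : Fin (m + 1) → Param p → ℝ) (Θ : Set (Param p)) (lam : Fin m → ℝ) (α : ℝ) :
    EReal :=
  ⨅ θ ∈ Θ, ((augLagrangian ℓ θ lam α : ℝ) : EReal)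

/-- `(λ, α)` maximizes the augmented dual function over `ℝ^m × (0, ∞)`. -/
def IsDualSolution (ℓ : Fin (m + 1) → Param p → ℝ) (Θ : Set (Param p)) (lam : Fin m → ℝ) (α : ℝ) :
    Prop :=
  0 < α ∧ ∀ (lam' : Fin m → ℝ) (α' : ℝ), 0 < α' →
    dualFunction ℓ Θ lam' α' ≤ dualFunction ℓ Θ lam α

/-- `‖λ‖₁`. -/
def l1Norm (lam : Fin m → ℝ) : ℝ := ∑ i, |lam i|

/-! ### Regularity conditions on a program -/

/-- For some `u > 0` and some real `pbar` above the optimal value, the level set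
`{θ ∈ Θ : ℓ 0 θ ≤ pbar, ℓ i θ ≤ u for all i ≥ 1}` is compact. -/
def CompactLevelSet (ℓ : Fin (m + 1) → Param p → ℝ) (Θ : Set (Param p)) : Prop :=
  ∃ u pbar : ℝ, 0 < u ∧ primalValue ℓ Θ < (pbar : EReal) ∧
    IsCompact {θ | θ ∈ Θ ∧ ℓ 0 θ ≤ pbar ∧ ∀ i : Fin m, ℓ i.succ θ ≤ u}

/-- The objective and the constraints are `C²` around every point of `Θ`. -/
def SmoothProgram (ℓ : Fin (m + 1) → Param p → ℝ) (Θ : Set (Param p)) : Prop :=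
  ∀ i, ∀ θ ∈ Θ, ContDiffAt ℝ 2 (ℓ i) θ

/-- LICQ: the gradients of the active constraints are linearly independent at an optimal point. -/
def LICQ (ℓ : Fin (m + 1) → Param p → ℝ) (Θ : Set (Param p)) : Prop :=
  ∀ θ, IsPrimalSolution ℓ Θ θ →
    LinearIndependent ℝ (fun i : {i : Fin m // ℓ i.succ θ = 0} => gradient (ℓ i.1.succ) θ)

/-- The ordinary Lagrangian `ℓ 0 + ∑ λ i ℓ i`, that is `L(·, λ, 0)`. -/
def lagrangian (ℓ : Fin (m + 1) → Param p → ℝ) (lam : Fin m → ℝ) (θ : Param p) : ℝ :=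
  ℓ 0 θ + ∑ i : Fin m, lam i * ℓ i.succ θ

/-- The KKT conditions at `(θ, λ)`. -/
def KKT (ℓ : Fin (m + 1) → Param p → ℝ) (Θ : Set (Param p)) (θ : Param p) (lam : Fin m → ℝ) :
    Prop :=
  θ ∈ feasibleSet ℓ Θ ∧ (∀ i, 0 ≤ lam i) ∧ (∀ i : Fin m, lam i * ℓ i.succ θ = 0) ∧
    gradient (lagrangian ℓ lam) θ = 0

/-- The critical cone at `(θ, λ)`. -/
def criticalCone (ℓ : Fin (m + 1) → Param p → ℝ) (θ : Param p) (lam : Fin m → ℝ) :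
    Set (Param p) :=
  {z | ∀ i : Fin m, ℓ i.succ θ = 0 →
    (0 < lam i → inner ℝ (gradient (ℓ i.succ) θ) z = 0) ∧
    (lam i = 0 → inner ℝ (gradient (ℓ i.succ) θ) z ≤ 0)}

/-- The second-order sufficient condition: a multiplier vector satisfies the KKT conditions at the
optimal point, and the Hessian of the Lagrangian is positive on the nonzero vectors of the critical
cone. (If there are several optimal points, one multiplier vector serves them all.) -/
def SOSC (ℓ : Fin (m + 1) → Param p → ℝ) (Θ : Set (Param p)) : Prop :=
  ∃ lam : Fin m → ℝ, ∀ θ, IsPrimalSolution ℓ Θ θ →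
    KKT ℓ Θ θ lam ∧
    ∀ z ∈ criticalCone ℓ θ lam, z ≠ 0 → 0 < fderiv ℝ (fderiv ℝ (lagrangian ℓ lam)) θ z z

/-! ### Expected and empirical risks -/

variable {X Y : Type*}

/-- The mean loss of `f_θ` over the sample `s`. -/
def sampleMean {n : ℕ} (f : Param p → X → Y) (lossᵢ : Y → Y → ℝ) (s : Fin n → X × Y)
    (θ : Param p) : ℝ :=
  (1 / (n : ℝ)) * ∑ k, lossᵢ (f θ (s k).1) (s k).2

/-- A data set with `N i` examples for the `i`-th risk. -/
abbrev Sample (X Y : Type*) {m : ℕ} (N : Fin (m + 1) → ℕ) : Type _ :=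
  (i : Fin (m + 1)) → Fin (N i) → X × Y

/-- The empirical risks. -/
def empRisk (f : Param p → X → Y) (loss : Fin (m + 1) → Y → Y → ℝ) {N : Fin (m + 1) → ℕ}
    (S : Sample X Y N) (i : Fin (m + 1)) (θ : Param p) : ℝ :=
  sampleMean f (loss i) (S i) θ

/-- Continuity of the parametrization, and continuity and uniform boundedness of the losses. -/
def ContinuityAssumption [TopologicalSpace Y] (f : Param p → X → Y)
    (loss : Fin (m + 1) → Y → Y → ℝ) (Θ : Set (Param p)) : Prop :=
  (∀ x, ContinuousOn (fun θ => f θ x) Θ) ∧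
  (∀ i y, Continuous (fun v => loss i v y)) ∧
  ∀ i, ∃ C : ℝ, ∀ v y, |loss i v y| ≤ C

variable [MeasurableSpace X] [MeasurableSpace Y]

/-- The expected risks `ℓ i (f_θ) = E_{(x, y) ∼ D i} [loss i (f_θ x) y]`. -/
def risk (f : Param p → X → Y) (loss : Fin (m + 1) → Y → Y → ℝ)
    (D : Fin (m + 1) → Measure (X × Y)) (i : Fin (m + 1)) (θ : Param p) : ℝ :=
  ∫ z, loss i (f θ z.1) z.2 ∂(D i)

/-- `good` holds with probability at least `q`: it holds on a measurable event of probability at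
least `q`. -/
def HoldsWithProb {Ω : Type*} [MeasurableSpace Ω] (μ : Measure Ω) (good : Ω → Prop) (q : ℝ) :
    Prop :=
  ∃ A : Set Ω, MeasurableSet A ∧ (∀ ω ∈ A, good ω) ∧ ENNReal.ofReal q ≤ μ A

/-- `μ` is the law of a data set in which, for each `i`, the `N i` examples for the `i`-th risk are
i.i.d. with law `D i`. Nothing is assumed on the dependence between different `i`. -/
def IsSampleLaw (D : Fin (m + 1) → Measure (X × Y)) (N : Fin (m + 1) → ℕ)
    (μ : Measure (Sample X Y N)) : Prop :=
  ∀ i, μ.map (fun S => S i) = Measure.pi (fun _ : Fin (N i) => D i)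

/-- Uniform convergence with rates `ζ i N δ ≥ 0`, nonincreasing in the sample size `N`. -/
def UniformConvergence (f : Param p → X → Y) (loss : Fin (m + 1) → Y → Y → ℝ)
    (D : Fin (m + 1) → Measure (X × Y)) (Θ : Set (Param p)) (ζ : Fin (m + 1) → ℕ → ℝ → ℝ) : Prop :=
  ∀ i, ∀ δ : ℝ, 0 < δ → δ < 1 →
    (∀ n, 0 < n → 0 ≤ ζ i n δ) ∧
    (∀ n n', 0 < n → n ≤ n' → ζ i n' δ ≤ ζ i n δ) ∧
    ∀ n, 0 < n → HoldsWithProb (Measure.pi (fun _ : Fin n => D i))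
      (fun s => ∀ θ ∈ Θ, |risk f loss D i θ - sampleMean f (loss i) s θ| ≤ ζ i n δ) (1 - δ)

/-- The learner `A`, which maps data sets to parameters, is probably approximately correct and
probably approximately feasible for the constrained problem with optimal value `Pstar`. -/
def IsPACCLearner (f : Param p → X → Y) (loss : Fin (m + 1) → Y → Y → ℝ)
    (D : Fin (m + 1) → Measure (X × Y)) (Θ : Set (Param p)) (Pstar : ℝ)
    (A : (N : Fin (m + 1) → ℕ) → Sample X Y N → Param p) : Prop :=
  ∀ ε δ : ℝ, 0 < ε → 0 < δ → δ < 1 → ∃ N₀ : ℕ, ∀ N : Fin (m + 1) → ℕ, (∀ i, N₀ ≤ N i) →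
    ∀ μ : Measure (Sample X Y N), IsSampleLaw D N μ →
      HoldsWithProb μ
        (fun S => A N S ∈ Θ ∧ |Pstar - risk f loss D 0 (A N S)| ≤ ε ∧
          ∀ i : Fin m, risk f loss D i.succ (A N S) ≤ ε)
        (1 - δ)

/-- The learner `A` solves the empirical constrained problem, asymptotically almost surely and with
stochastically bounded dual solutions: for every `δ` there are `B` and `N₀` such that, for sample
sizes at least `N₀`, with probability at least `1 - δ`, the empirical problem has a compact level
set, `A` returns a solution of it, and its augmented dual has a solution bounded by `B`. -/
def SolvesEmpiricalProblem (f : Param p → X → Y) (loss : Fin (m + 1) → Y → Y → ℝ)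
    (D : Fin (m + 1) → Measure (X × Y)) (Θ : Set (Param p))
    (A : (N : Fin (m + 1) → ℕ) → Sample X Y N → Param p) : Prop :=
  ∀ δ : ℝ, 0 < δ → δ < 1 → ∃ (B : ℝ) (N₀ : ℕ), ∀ N : Fin (m + 1) → ℕ, (∀ i, N₀ ≤ N i) →
    ∀ μ : Measure (Sample X Y N), IsSampleLaw D N μ →
      HoldsWithProb μ
        (fun S => CompactLevelSet (empRisk f loss S) Θ ∧
          IsPrimalSolution (empRisk f loss S) Θ (A N S) ∧
          ∃ (lam : Fin m → ℝ) (α : ℝ), IsDualSolution (empRisk f loss S) Θ lam α ∧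
            l1Norm lam ≤ B ∧ α ≤ B)
        (1 - δ)

end PACC

end

namespace PACC

variable {p m : ℕ}

/-! ### The augmented Lagrangian and weak duality -/

/-! For `α > 0`, `α * Psi x (l / α)` is the minimum of `l * w + α * w ^ 2` over `w ≥ x`, attained at
`max x (-l / (2 * α))`. Hence any bound `w` on the constraint violations bounds the augmented
Lagrangian from above. Taking `w = 0` gives weak duality with multipliers of any sign; taking `w =
ζ` prices a violation of size `ζ`.

There is no duality gap despite nonconvexity, because diverging penalties force points of low
augmented Lagrangian to accumulate at feasible points (`exists_tendsto_feasible`). Consequently a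
dual optimum has value `P*` (`IsDualSolution.le_augLagrangian`).

The dual optimum is attained by the multiplier of the second-order condition with a large penalty.
Otherwise points with augmented Lagrangian below `P*` would approach a solution along a critical
direction of nonpositive curvature (`false_of_tendsto_of_augLagrangian_lt`).

The generalization bound is then deterministic: the solution of each of two `ζ`-close programs is
`ζ`-infeasible at worst for the other, and strong duality in each program limits what that
infeasibility can gain (`abs_sub_le_of_uniformly_close`). A union bound makes the programs close
with high probability. -/

lemma mul_Psi_eq {α : ℝ} (hα : 0 < α) (x l : ℝ) :
    α * Psi x (l / α) = l * max x (-l / (2 * α)) + α * max x (-l / (2 * α)) ^ 2 := by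
  unfold Psi
  rcases le_total (-l / (2 * α)) x with h | h
  · have h' : 0 ≤ 2 * x + l / α := by
      have : l / α = -(2 * (-l / (2 * α))) := by field_simp
      linarith
    rw [max_eq_right h', max_eq_left h]
    field_simp
    ring
  · have h' : 2 * x + l / α ≤ 0 := by
      have : l / α = -(2 * (-l / (2 * α))) := by field_simp
      linarith
    rw [max_eq_left h', max_eq_right h]
    field_simp
    ring

/-- The parabola `t ↦ l * t + α * t ^ 2` has its vertex at `-l / (2 * α)`, so on `[x, ∞)` the
truncated vertex is its minimizer and `w` can do no better. -/
lemma mul_Psi_le {α : ℝ} (hα : 0 < α) {x w : ℝ} (l : ℝ) (h : x ≤ w) :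
    α * Psi x (l / α) ≤ l * w + α * w ^ 2 := by
  rw [mul_Psi_eq hα]
  have hmin : 0 ≤ α * (w + l / (2 * α)) ^ 2 := by positivity
  have e : ∀ t : ℝ, l * t + α * t ^ 2 = α * (t + l / (2 * α)) ^ 2 - l ^ 2 / (4 * α) := by
    intro t; field_simp; ring
  rw [e, e w]
  have : (max x (-l / (2 * α)) + l / (2 * α)) ^ 2 ≤ (w + l / (2 * α)) ^ 2 := by
    have hneg : -l / (2 * α) = -(l / (2 * α)) := by ring
    rcases le_total (-l / (2 * α)) x with h' | h'
    · rw [max_eq_left h']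
      apply pow_le_pow_left₀ <;> linarith
    · rw [max_eq_right h', hneg]
      simpa using sq_nonneg _
  gcongr

/-- After completing the square, the left side compares with the squared positive part of `x + l /
(2 * α)`, and a shift by a nonnegative amount only enlarges a positive part. Up to an error
vanishing as `α → ∞`, the augmented term thus dominates a quadratic penalty. -/
lemma mul_max_sq_le_mul_Psi {α : ℝ} (hα : 0 < α) (x : ℝ) {l : ℝ} (hl : 0 ≤ l) :
    α * max x 0 ^ 2 ≤ α * Psi x (l / α) + l ^ 2 / (4 * α) := by
  have e : α * Psi x (l / α) + l ^ 2 / (4 * α) = α * (max 0 (2 * x + l / α) / 2) ^ 2 := by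
    unfold Psi; field_simp; ring
  rw [e]
  have h0 : 0 ≤ l / α := by positivity
  have : max x 0 ≤ max 0 (2 * x + l / α) / 2 := by
    rw [le_div_iff₀ two_pos]
    rcases le_total x 0 with h | h
    · rw [max_eq_right h]; simp
    · rw [max_eq_left h]; exact le_max_of_le_right (by linarith)
  gcongr

lemma augLagrangian_eq (ℓ : Fin (m + 1) → Param p → ℝ) (θ : Param p) (lam : Fin m → ℝ) {α : ℝ}
    (hα : 0 < α) :
    augLagrangian ℓ θ lam α = ℓ 0 θ + ∑ i : Fin m,
      (lam i * max (ℓ i.succ θ) (-lam i / (2 * α)) +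
        α * max (ℓ i.succ θ) (-lam i / (2 * α)) ^ 2) := by
  simp only [augLagrangian, Finset.mul_sum, mul_Psi_eq hα]

/-- At a point whose constraint violations are at most `w`, the augmented Lagrangian exceeds the
objective by at most `‖λ‖₁ w + α m w²`. -/
lemma augLagrangian_le {ℓ : Fin (m + 1) → Param p → ℝ} {θ : Param p} (lam : Fin m → ℝ) {α w : ℝ}
    (hα : 0 < α) (hw : 0 ≤ w) (h : ∀ i : Fin m, ℓ i.succ θ ≤ w) :
    augLagrangian ℓ θ lam α ≤ ℓ 0 θ + l1Norm lam * w + α * m * w ^ 2 := by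
  have h1 : ∀ i ∈ Finset.univ, α * Psi (ℓ (Fin.succ i) θ) (lam i / α) ≤ |lam i| * w + α * w ^ 2 :=
    fun i _ => (mul_Psi_le hα _ (h i)).trans (by gcongr; exact le_abs_self _)
  have h2 := Finset.sum_le_sum h1
  rw [Finset.sum_add_distrib, ← Finset.sum_mul] at h2
  simp only [Finset.sum_const, Finset.card_univ, Fintype.card_fin, nsmul_eq_mul] at h2
  unfold augLagrangian l1Norm
  rw [Finset.mul_sum]
  linarith

lemma augLagrangian_le_of_mem_feasibleSet {ℓ : Fin (m + 1) → Param p → ℝ} {Θ : Set (Param p)}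
    {θ : Param p} (h : θ ∈ feasibleSet ℓ Θ) (lam : Fin m → ℝ) {α : ℝ} (hα : 0 < α) :
    augLagrangian ℓ θ lam α ≤ ℓ 0 θ := by
  simpa using augLagrangian_le lam hα le_rfl h.2

lemma IsPrimalSolution.primalValue_eq {ℓ : Fin (m + 1) → Param p → ℝ} {Θ : Set (Param p)}
    {θ : Param p} (h : IsPrimalSolution ℓ Θ θ) : primalValue ℓ Θ = (ℓ 0 θ : EReal) :=
  le_antisymm (iInf₂_le θ h.1) (le_iInf₂ fun θ' h' => EReal.coe_le_coe_iff.2 (h.2 θ' h'))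

lemma dualFunction_le_primalValue (ℓ : Fin (m + 1) → Param p → ℝ) (Θ : Set (Param p))
    (lam : Fin m → ℝ) {α : ℝ} (hα : 0 < α) : dualFunction ℓ Θ lam α ≤ primalValue ℓ Θ :=
  le_iInf₂ fun θ h => (iInf₂_le θ h.1).trans
    (EReal.coe_le_coe_iff.2 (augLagrangian_le_of_mem_feasibleSet h lam hα))

/-- A lower bound `ℓ 0 θ` on the augmented Lagrangian at a feasible `θ` certifies dual
optimality. -/
lemma isDualSolution_of_le {ℓ : Fin (m + 1) → Param p → ℝ} {Θ : Set (Param p)} {θ : Param p}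
    (h : IsPrimalSolution ℓ Θ θ) {lam : Fin m → ℝ} {α : ℝ} (hα : 0 < α)
    (hle : ∀ θ' ∈ Θ, ℓ 0 θ ≤ augLagrangian ℓ θ' lam α) : IsDualSolution ℓ Θ lam α :=
  ⟨hα, fun lam' _ hα' => (dualFunction_le_primalValue ℓ Θ lam' hα').trans
    (h.primalValue_eq ▸ le_iInf₂ fun θ' h' => EReal.coe_le_coe_iff.2 (hle θ' h'))⟩

/-! ### Existence of solutions and strong duality -/

/-- A feasible point with objective below the level `b` exists because `b` exceeds the optimal
value. The feasible points of the level set form a nonempty compact set, and feasible points outside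
it have objective above `b`. -/
lemma exists_isPrimalSolution {ℓ : Fin (m + 1) → Param p → ℝ} {Θ : Set (Param p)}
    (hℓ : ∀ i, ContinuousOn (ℓ i) Θ) (hK : CompactLevelSet ℓ Θ) :
    ∃ θ, IsPrimalSolution ℓ Θ θ := by
  obtain ⟨u, b, hu, hb, hK⟩ := hK
  obtain ⟨θ₀, h₀, hlt⟩ : ∃ θ ∈ feasibleSet ℓ Θ, ℓ 0 θ < b := by
    simpa [primalValue, iInf_lt_iff] using hb
  set K := {θ | θ ∈ Θ ∧ ℓ 0 θ ≤ b ∧ ∀ i : Fin m, ℓ i.succ θ ≤ u}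
  have hsub : K ⊆ Θ := fun θ h => h.1
  have hF : IsCompact {θ | θ ∈ K ∧ ∀ i : Fin m, ℓ i.succ θ ≤ 0} := by
    have hcl : IsClosed {θ | θ ∈ K ∧ ∀ i : Fin m, ℓ i.succ θ ≤ 0} := by
      -- Continuity is available only on `Θ`, so closedness is read off from preimages relative to
      -- the closed set `K`.
      have : {θ | θ ∈ K ∧ ∀ i : Fin m, ℓ i.succ θ ≤ 0}
          = K ∩ ⋂ i : Fin m, (K ∩ (ℓ i.succ) ⁻¹' Set.Iic 0) := by
        ext; simp +contextual [forall_and]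
      rw [this]
      exact hK.isClosed.inter (isClosed_iInter fun i =>
        ((hℓ i.succ).mono hsub).preimage_isClosed_of_isClosed hK.isClosed isClosed_Iic)
    exact hK.of_isClosed_subset hcl fun θ h => h.1
  obtain ⟨θ, hθ, hmin⟩ := hF.exists_isMinOn
    ⟨θ₀, ⟨h₀.1, hlt.le, fun i => (h₀.2 i).trans hu.le⟩, h₀.2⟩
    ((hℓ 0).mono fun θ h => h.1.1)
  refine ⟨θ, ⟨hθ.1.1, hθ.2⟩, fun θ' h' => ?_⟩
  rcases le_total (ℓ 0 θ') b with hb' | hb'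
  · exact hmin ⟨⟨h'.1, hb', fun i => (h'.2 i).trans hu.le⟩, h'.2⟩
  · exact hθ.1.2.1.trans hb'

/-- Points at which the augmented Lagrangian with growing penalties stays at most `c` accumulate at
a feasible point with objective at most `c`. -/
lemma exists_tendsto_feasible {ℓ : Fin (m + 1) → Param p → ℝ} {Θ : Set (Param p)}
    (hℓ : ∀ i, ContinuousOn (ℓ i) Θ) (hbdd : BddBelow (ℓ 0 '' Θ)) (hK : CompactLevelSet ℓ Θ)
    {lam : Fin m → ℝ} (hlam : ∀ i, 0 ≤ lam i) {c : ℝ} (hc : (c : EReal) ≤ primalValue ℓ Θ)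
    {θ : ℕ → Param p} (hθ : ∀ k, θ k ∈ Θ)
    (hL : ∀ k, augLagrangian ℓ (θ k) lam ((k : ℝ) + 1) ≤ c) :
    ∃ θ' ∈ feasibleSet ℓ Θ, ℓ 0 θ' ≤ c ∧
      ∃ φ : ℕ → ℕ, StrictMono φ ∧ Tendsto (θ ∘ φ) atTop (𝓝 θ') := by
  obtain ⟨u, b, hu, hb, hK⟩ := hK
  have hcb : c < b := EReal.coe_lt_coe_iff.1 (hc.trans_lt hb)
  obtain ⟨B, hB⟩ := hbdd
  have hB' : ∀ k, B ≤ ℓ 0 (θ k) := fun k => hB ⟨_, hθ k, rfl⟩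
  set Q : ℝ := ∑ i, lam i ^ 2 / 4
  have hQ : 0 ≤ Q := Finset.sum_nonneg fun i _ => by positivity
  have key : ∀ k : ℕ, ℓ 0 (θ k) + ((k : ℝ) + 1) * ∑ i : Fin m, max (ℓ i.succ (θ k)) 0 ^ 2
      ≤ c + Q / ((k : ℝ) + 1) := by
    intro k
    have hk : (0 : ℝ) < (k : ℝ) + 1 := by positivity
    have h1 := Finset.sum_le_sum fun (i : Fin m) (_ : i ∈ Finset.univ) =>
      mul_max_sq_le_mul_Psi hk (ℓ i.succ (θ k)) (hlam i)
    rw [Finset.sum_add_distrib, ← Finset.mul_sum, ← Finset.mul_sum] at h1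
    have h2 : ∑ i, lam i ^ 2 / (4 * ((k : ℝ) + 1)) = Q / ((k : ℝ) + 1) := by
      rw [Finset.sum_div]
      exact Finset.sum_congr rfl fun i _ => by field_simp
    have h3 := hL k
    unfold augLagrangian at h3
    linarith
  have hlim : ∀ a : ℝ, Tendsto (fun k : ℕ => a / ((k : ℝ) + 1)) atTop (𝓝 0) := fun a =>
    tendsto_const_nhds.div_atTop
      (tendsto_atTop_add_const_right _ _ tendsto_natCast_atTop_atTop)
  have hobj : ∀ k : ℕ, ℓ 0 (θ k) ≤ c + Q / ((k : ℝ) + 1) := fun k =>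
    (le_add_of_nonneg_right (by positivity)).trans (key k)
  -- With the objective bounded below by `B`, the whole penalty is at most `c + Q - B`, so squared
  -- violations decay like `1 / (k + 1)`.
  have hsq : ∀ (i : Fin m) (k : ℕ), max (ℓ i.succ (θ k)) 0 ^ 2 ≤ (c + Q - B) / ((k : ℝ) + 1) := by
    intro i k
    have hk : (0 : ℝ) < (k : ℝ) + 1 := by positivity
    rw [le_div_iff₀' hk]
    have h1 : max (ℓ i.succ (θ k)) 0 ^ 2 ≤ ∑ i : Fin m, max (ℓ i.succ (θ k)) 0 ^ 2 :=
      Finset.single_le_sum (f := fun i : Fin m => max (ℓ i.succ (θ k)) 0 ^ 2)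
        (fun i _ => by positivity) (Finset.mem_univ i)
    have h2 : Q / ((k : ℝ) + 1) ≤ Q := div_le_self hQ (by linarith [k.cast_nonneg (α := ℝ)])
    have h3 := mul_le_mul_of_nonneg_left h1 hk.le
    linarith [key k, hB' k]
  have hcon : ∀ i : Fin m, Tendsto (fun k => max (ℓ i.succ (θ k)) 0) atTop (𝓝 0) := by
    intro i
    have h := squeeze_zero (fun k => by positivity) (hsq i) (hlim _)
    have h' := h.sqrt
    simpa [Real.sqrt_sq] using h'
  -- The strict inequalities `c < b` and `0 < u` absorb the vanishing errors, so the tail lies in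
  -- the compact level set.
  have hev : ∀ᶠ k in atTop, θ k ∈ {θ | θ ∈ Θ ∧ ℓ 0 θ ≤ b ∧ ∀ i : Fin m, ℓ i.succ θ ≤ u} := by
    have h1 : ∀ᶠ k : ℕ in atTop, Q / ((k : ℝ) + 1) < b - c :=
      (hlim Q).eventually_lt_const (by linarith)
    have h2 : ∀ᶠ k in atTop, ∀ i : Fin m, max (ℓ i.succ (θ k)) 0 < u :=
      eventually_all.2 fun i => (hcon i).eventually_lt_const hu
    filter_upwards [h1, h2] with k h1 h2
    exact ⟨hθ k, by linarith [hobj k], fun i => (le_max_left _ _).trans (h2 i).le⟩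
  obtain ⟨θ', h', φ, hφ, hlimφ⟩ := hK.tendsto_subseq' hev.frequently
  have hw : Tendsto (θ ∘ φ) atTop (𝓝[Θ] θ') :=
    tendsto_nhdsWithin_iff.2 ⟨hlimφ, Eventually.of_forall fun k => hθ _⟩
  have hval : ∀ i, Tendsto (fun k => ℓ i (θ (φ k))) atTop (𝓝 (ℓ i θ')) := fun i =>
    ((hℓ i) θ' h'.1).tendsto.comp hw
  refine ⟨θ', ⟨h'.1, fun i => ?_⟩, ?_, φ, hφ, hlimφ⟩
  · exact le_of_tendsto_of_tendsto' (hval i.succ) ((hcon i).comp hφ.tendsto_atTop)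
      fun k => le_max_left _ _
  · have h := tendsto_const_nhds (x := c).add ((hlim Q).comp hφ.tendsto_atTop)
    rw [add_zero] at h
    exact le_of_tendsto_of_tendsto' (hval 0) h fun k => hobj _

/-- Strong duality: the augmented Lagrangian at a dual solution is bounded below by the optimal
value. -/
lemma IsDualSolution.le_augLagrangian {ℓ : Fin (m + 1) → Param p → ℝ} {Θ : Set (Param p)}
    (hℓ : ∀ i, ContinuousOn (ℓ i) Θ) (hbdd : BddBelow (ℓ 0 '' Θ)) (hK : CompactLevelSet ℓ Θ)
    {lam : Fin m → ℝ} {α : ℝ} (hd : IsDualSolution ℓ Θ lam α) {θ : Param p}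
    (hp : IsPrimalSolution ℓ Θ θ) {θ' : Param p} (hθ' : θ' ∈ Θ) :
    ℓ 0 θ ≤ augLagrangian ℓ θ' lam α := by
  by_contra! hlt
  obtain ⟨c, hc1, hc2⟩ := exists_between hlt
  -- Dual optimality keeps every other dual value below `c`; zero multipliers with growing penalties
  -- already lead to a feasible point of objective below the optimum.
  have hex : ∀ k : ℕ, ∃ η ∈ Θ, augLagrangian ℓ η (fun _ => 0) ((k : ℝ) + 1) < c := by
    intro k
    have h1 : dualFunction ℓ Θ (fun _ => 0) ((k : ℝ) + 1) < (c : EReal) :=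
      ((hd.2 _ _ (by positivity)).trans (iInf₂_le θ' hθ')).trans_lt (EReal.coe_lt_coe_iff.2 hc1)
    simpa [dualFunction, iInf_lt_iff] using h1
  choose η hη hηc using hex
  obtain ⟨θs, hs, hsc, -⟩ := exists_tendsto_feasible hℓ hbdd hK (fun _ => le_rfl)
    (by rw [hp.primalValue_eq]; exact EReal.coe_le_coe_iff.2 hc2.le) hη fun k => (hηc k).le
  linarith [hp.2 θs hs]

/-! ### Second-order sufficient conditions give a dual solution -/

/-- Second-order Taylor expansion at a point where the derivative is differentiable. -/
lemma taylor_two_isLittleO {E : Type*} [NormedAddCommGroup E] [NormedSpace ℝ E] {F : E → ℝ} {x : E}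
    (hF : ∀ᶠ y in 𝓝 x, DifferentiableAt ℝ F y) (hF' : DifferentiableAt ℝ (fderiv ℝ F) x) :
    (fun h => F (x + h) - F x - fderiv ℝ F x h - 1 / 2 * fderiv ℝ (fderiv ℝ F) x h h)
      =o[𝓝 0] fun h => ‖h‖ ^ 2 := by
  rw [Asymptotics.isLittleO_iff]
  intro c hc
  have h1 := Asymptotics.isLittleO_iff.1 (hasFDerivAt_iff_isLittleO_nhds_zero.1 hF'.hasFDerivAt) hc
  have h2 : ∀ᶠ h in 𝓝 (0 : E), DifferentiableAt ℝ F (x + h) := by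
    have : Tendsto (fun h : E => x + h) (𝓝 0) (𝓝 x) := by
      simpa using (continuous_const_add x).tendsto (0 : E)
    exact this.eventually hF
  obtain ⟨r, hr, hball⟩ := Metric.eventually_nhds_iff_ball.1 (h1.and h2)
  filter_upwards [Metric.ball_mem_nhds (0 : E) hr] with h hh
  have hmem : ∀ s ∈ Set.Icc (0 : ℝ) 1, s • h ∈ Metric.ball (0 : E) r := by
    intro s hs
    rw [mem_ball_zero_iff] at hh ⊢
    rw [norm_smul, Real.norm_of_nonneg hs.1]
    exact (mul_le_of_le_one_left (norm_nonneg h) hs.2).trans_lt hh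
  -- The Taylor remainder along the segment has as derivative the first-order remainder of `fderiv ℝ
  -- F` at `s • h`, applied to `h`. This is at most `c * ‖h‖ * ‖h‖`, and the mean value inequality
  -- concludes.
  have hderiv : ∀ s ∈ Set.Icc (0 : ℝ) 1, HasDerivWithinAt
      (fun s : ℝ => F (x + s • h) - s * fderiv ℝ F x h
        - s ^ 2 * (1 / 2 * fderiv ℝ (fderiv ℝ F) x h h))
      ((fderiv ℝ F (x + s • h) - fderiv ℝ F x - fderiv ℝ (fderiv ℝ F) x (s • h)) h)
      (Set.Icc 0 1) s := by
    intro s hs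
    have e1 : HasDerivAt (fun s : ℝ => x + s • h) h s := by
      simpa using ((hasDerivAt_id s).smul_const h).const_add x
    have e2 := ((hball _ (hmem s hs)).2.hasFDerivAt.comp_hasDerivAt s e1)
    have e3 := (hasDerivAt_id s).mul_const (fderiv ℝ F x h)
    have e4 := (hasDerivAt_pow 2 s).mul_const (1 / 2 * fderiv ℝ (fderiv ℝ F) x h h)
    refine (((e2.sub e3).sub e4).congr_deriv ?_).hasDerivWithinAt
    simp
    ring
  have hbound := norm_image_sub_le_of_norm_deriv_le_segment_01' (C := c * ‖h‖ * ‖h‖) hderiv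
    (fun s hs => by
      have hs' : s ∈ Set.Icc (0 : ℝ) 1 := ⟨hs.1, hs.2.le⟩
      refine (ContinuousLinearMap.le_opNorm _ _).trans ?_
      gcongr
      refine (hball _ (hmem s hs')).1.trans ?_
      gcongr
      rw [norm_smul, Real.norm_of_nonneg hs.1]
      exact mul_le_of_le_one_left (norm_nonneg h) hs.2.le)
  simp only [one_smul, zero_smul, add_zero, one_mul, zero_mul, one_pow, sub_zero, ne_eq,
    OfNat.ofNat_ne_zero, not_false_eq_true, zero_pow] at hbound
  rw [Real.norm_of_nonneg (sq_nonneg ‖h‖)]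
  calc _ = _ := by congr 1; ring
    _ ≤ _ := hbound
    _ = _ := by ring

/-- The second-order difference quotient at a critical point along a sequence that converges in
direction. -/
lemma tendsto_second_order_quotient {E : Type*} [NormedAddCommGroup E] [NormedSpace ℝ E]
    {F : E → ℝ} {x z : E} (hF : ContDiffAt ℝ 2 F x) (hcrit : fderiv ℝ F x = 0) {c : ℕ → ℝ}
    {d : ℕ → E} (hd : Tendsto d atTop (𝓝 0)) (hz : Tendsto (fun n => c n • d n) atTop (𝓝 z)) :
    Tendsto (fun n => c n ^ 2 * (F (x + d n) - F x)) atTop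
      (𝓝 (1 / 2 * fderiv ℝ (fderiv ℝ F) x z z)) := by
  have hdiff : ∀ᶠ y in 𝓝 x, DifferentiableAt ℝ F y :=
    (hF.eventually (by simp)).mono fun y hy => hy.differentiableAt (by simp)
  have hF' : DifferentiableAt ℝ (fderiv ℝ F) x :=
    (hF.fderiv_right (m := 1) (by norm_num)).differentiableAt (by simp)
  have h1 := (taylor_two_isLittleO hdiff hF').comp_tendsto hd
  have h2 : (fun n => c n ^ 2 * (F (x + d n) - F x - fderiv ℝ F x (d n)
      - 1 / 2 * fderiv ℝ (fderiv ℝ F) x (d n) (d n))) =o[atTop] fun _ => (1 : ℝ) := by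
    have h3 := (Asymptotics.isBigO_refl (fun n => c n ^ 2) atTop).mul_isLittleO h1
    refine h3.trans_isBigO ?_
    -- Convergence of `c n • d n` bounds the rescaled squared norms, which turns the remainder `o(‖d
    -- n‖ ^ 2)` into `o(1)`.
    have h4 : Tendsto (fun n => c n ^ 2 * ‖d n‖ ^ 2) atTop (𝓝 (‖z‖ ^ 2)) := by
      refine (hz.norm.pow 2).congr fun n => ?_
      rw [norm_smul, mul_pow, Real.norm_eq_abs, sq_abs]
    exact h4.isBigO_one ℝ
  have h5 := (Asymptotics.isLittleO_one_iff ℝ).1 h2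
  have h6 : Tendsto (fun n => 1 / 2 * fderiv ℝ (fderiv ℝ F) x (c n • d n) (c n • d n)) atTop
      (𝓝 (1 / 2 * fderiv ℝ (fderiv ℝ F) x z z)) :=
    ((((fderiv ℝ (fderiv ℝ F) x).isBoundedBilinearMap.continuous.tendsto (z, z)).comp
      (hz.prodMk_nhds hz)).const_mul _)
  have h7 := h5.add h6
  rw [zero_add] at h7
  refine h7.congr fun n => ?_
  simp [hcrit]
  ring

/-- Subsequential directions of a sequence that converges to, but avoids, a point. -/
lemma exists_subseq_direction {E : Type*} [NormedAddCommGroup E] [NormedSpace ℝ E] [ProperSpace E]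
    {d : ℕ → E} (hne : ∀ n, d n ≠ 0) :
    ∃ z : E, z ≠ 0 ∧ ∃ ψ : ℕ → ℕ, StrictMono ψ ∧
      Tendsto (fun n => ‖d (ψ n)‖⁻¹ • d (ψ n)) atTop (𝓝 z) := by
  have hmem : ∀ n, ‖d n‖⁻¹ • d n ∈ Metric.sphere (0 : E) 1 := fun n => by
    simp [norm_smul, hne n]
  obtain ⟨z, hz, ψ, hψ, hlim⟩ := (isCompact_sphere (0 : E) 1).tendsto_subseq hmem
  exact ⟨z, fun h => by simp [h] at hz, ψ, hψ, hlim⟩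

lemma lagrangian_contDiffAt {ℓ : Fin (m + 1) → Param p → ℝ} {Θ : Set (Param p)}
    (hs : SmoothProgram ℓ Θ) (lam : Fin m → ℝ) {θ : Param p} (hθ : θ ∈ Θ) :
    ContDiffAt ℝ 2 (lagrangian ℓ lam) θ :=
  (hs 0 θ hθ).add (ContDiffAt.sum fun i _ => contDiffAt_const.mul (hs i.succ θ hθ))

lemma KKT.fderiv_lagrangian {ℓ : Fin (m + 1) → Param p → ℝ} {Θ : Set (Param p)} {θ : Param p}
    {lam : Fin m → ℝ} (h : KKT ℓ Θ θ lam) : fderiv ℝ (lagrangian ℓ lam) θ = 0 := by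
  ext z
  rw [← inner_gradient_left, h.2.2.2]
  simp

lemma KKT.lagrangian_eq {ℓ : Fin (m + 1) → Param p → ℝ} {Θ : Set (Param p)} {θ : Param p}
    {lam : Fin m → ℝ} (h : KKT ℓ Θ θ lam) : lagrangian ℓ lam θ = ℓ 0 θ := by
  simp [lagrangian, h.2.2.1]

/-- At a KKT point that satisfies the second-order sufficient condition, the augmented Lagrangian
with diverging penalties cannot stay below the objective along a sequence converging to the
point. -/
lemma false_of_tendsto_of_augLagrangian_lt {ℓ : Fin (m + 1) → Param p → ℝ} {Θ : Set (Param p)}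
    (hs : SmoothProgram ℓ Θ) {lam : Fin m → ℝ} {θ : Param p} (hkkt : KKT ℓ Θ θ lam)
    (hpos : ∀ z ∈ criticalCone ℓ θ lam, z ≠ 0 →
      0 < fderiv ℝ (fderiv ℝ (lagrangian ℓ lam)) θ z z)
    {α : ℕ → ℝ} (hα0 : ∀ n, 0 < α n) (hα : Tendsto α atTop atTop) {η : ℕ → Param p}
    (hη : Tendsto η atTop (𝓝 θ)) (hlt : ∀ n, augLagrangian ℓ (η n) lam (α n) < ℓ 0 θ) :
    False := by
  have hθ : θ ∈ Θ := hkkt.1.1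
  have hlam := hkkt.2.1
  -- The minimizing slack in the variational form of the augmented term; it dominates the constraint
  -- value.
  set w : ℕ → Fin m → ℝ := fun n i => max (ℓ i.succ (η n)) (-lam i / (2 * α n))
  have hobj : ∀ n, ℓ 0 (η n) - ℓ 0 θ + ∑ i, lam i * w n i + α n * ∑ i, w n i ^ 2 < 0 := by
    intro n
    have h := hlt n
    rw [augLagrangian_eq ℓ _ _ (hα0 n), Finset.sum_add_distrib, ← Finset.mul_sum] at h
    linarith
  -- Since `lam ≥ 0`, replacing `w` by the smaller constraint values yields the ordinary Lagrangian
  -- while keeping the penalty.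
  have hlag : ∀ n, lagrangian ℓ lam (η n) - lagrangian ℓ lam θ + α n * ∑ i, w n i ^ 2 < 0 := by
    intro n
    have h : ∑ i : Fin m, lam i * ℓ i.succ (η n) ≤ ∑ i, lam i * w n i :=
      Finset.sum_le_sum fun i _ => mul_le_mul_of_nonneg_left (le_max_left _ _) (hlam i)
    have h' := hobj n
    rw [hkkt.lagrangian_eq]
    unfold lagrangian
    linarith
  have hne : ∀ n, η n - θ ≠ 0 := by
    intro n h
    have h' := hlag n
    rw [sub_eq_zero.1 h] at h'
    have : 0 ≤ α n * ∑ i, w n i ^ 2 :=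
      mul_nonneg (hα0 n).le (Finset.sum_nonneg fun i _ => sq_nonneg _)
    linarith
  obtain ⟨z, hz0, ψ, hψ, hz⟩ := exists_subseq_direction hne
  set d : ℕ → Param p := fun n => η (ψ n) - θ
  set c : ℕ → ℝ := fun n => ‖d n‖⁻¹
  have hc0 : ∀ n, 0 ≤ c n := fun n => by positivity
  have hd : Tendsto d atTop (𝓝 0) := by
    simpa using (hη.comp hψ.tendsto_atTop).sub_const θ
  have hαψ : Tendsto (α ∘ ψ) atTop atTop := hα.comp hψ.tendsto_atTop
  have hadd : ∀ n, θ + d n = η (ψ n) := fun n => add_sub_cancel _ _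
  have hfirst : ∀ {F : Param p → ℝ}, ContDiffAt ℝ 2 F θ →
      Tendsto (fun n => c n * (F (η (ψ n)) - F θ)) atTop (𝓝 (fderiv ℝ F θ z)) := by
    intro F hF
    have h := (hF.differentiableAt (by simp)).hasFDerivAt.hasFDerivWithinAt (s := Set.univ)
    simpa only [hadd, smul_eq_mul] using
      h.lim hd (Eventually.of_forall fun _ => Set.mem_univ _) hz
  have hsecond : Tendsto (fun n => c n ^ 2 *
      (lagrangian ℓ lam (η (ψ n)) - lagrangian ℓ lam θ)) atTop
      (𝓝 (1 / 2 * fderiv ℝ (fderiv ℝ (lagrangian ℓ lam)) θ z z)) := by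
    simpa only [hadd] using tendsto_second_order_quotient (lagrangian_contDiffAt hs lam hθ)
      hkkt.fderiv_lagrangian hd hz
  -- The penalty is paid for by a decrease of the Lagrangian, which is of second order at a
  -- stationary point. After rescaling that decrease converges, and division by the diverging
  -- penalty makes the rescaled slacks vanish.
  have hwle : ∀ i n, (c n * w (ψ n) i) ^ 2 ≤
      -(c n ^ 2 * (lagrangian ℓ lam (η (ψ n)) - lagrangian ℓ lam θ)) / (α ∘ ψ) n := by
    intro i n
    rw [Function.comp_apply, le_div_iff₀ (hα0 _)]
    have h1 : w (ψ n) i ^ 2 ≤ ∑ i, w (ψ n) i ^ 2 :=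
      Finset.single_le_sum (f := fun i => w (ψ n) i ^ 2) (fun i _ => sq_nonneg _)
        (Finset.mem_univ i)
    have h2 := mul_le_mul_of_nonneg_left h1 (hα0 (ψ n)).le
    have h3 : α (ψ n) * w (ψ n) i ^ 2 ≤
      -(lagrangian ℓ lam (η (ψ n)) - lagrangian ℓ lam θ) := by linarith [hlag (ψ n)]
    have h4 := mul_le_mul_of_nonneg_left h3 (sq_nonneg (c n))
    linarith
  have hwlim : ∀ i, Tendsto (fun n => c n * w (ψ n) i) atTop (𝓝 0) := by
    intro i
    have h := squeeze_zero (fun n => sq_nonneg _) (hwle i) (hsecond.neg.div_atTop hαψ)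
    have h' := h.sqrt
    simp only [Real.sqrt_sq_eq_abs, Real.sqrt_zero] at h'
    exact (tendsto_zero_iff_abs_tendsto_zero _).2 h'
  have hcurv : fderiv ℝ (fderiv ℝ (lagrangian ℓ lam)) θ z z ≤ 0 := by
    have h := le_of_tendsto' hsecond (b := 0) fun n => by
      refine mul_nonpos_of_nonneg_of_nonpos (sq_nonneg _) ?_
      have : 0 ≤ α (ψ n) * ∑ i, w (ψ n) i ^ 2 :=
        mul_nonneg (hα0 _).le (Finset.sum_nonneg fun i _ => sq_nonneg _)
      linarith [hlag (ψ n)]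
    linarith
  have hact : ∀ i : Fin m, ℓ i.succ θ = 0 → fderiv ℝ (ℓ i.succ) θ z ≤ 0 := by
    intro i hi
    refine le_of_tendsto_of_tendsto' (hfirst (hs i.succ θ hθ)) (hwlim i) fun n => ?_
    rw [hi, sub_zero]
    exact mul_le_mul_of_nonneg_left (le_max_left _ _) (hc0 n)
  have hdesc : fderiv ℝ (ℓ 0) θ z ≤ 0 := by
    have hsum : Tendsto (fun n => -∑ i, lam i * (c n * w (ψ n) i)) atTop (𝓝 0) := by
      simpa using (tendsto_finsetSum Finset.univ fun i _ => (hwlim i).const_mul (lam i)).neg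
    refine le_of_tendsto_of_tendsto' (hfirst (hs 0 θ hθ)) hsum fun n => ?_
    have h1 : 0 ≤ α (ψ n) * ∑ i, w (ψ n) i ^ 2 :=
      mul_nonneg (hα0 _).le (Finset.sum_nonneg fun i _ => sq_nonneg _)
    have h2 : ℓ 0 (η (ψ n)) - ℓ 0 θ ≤ -∑ i, lam i * w (ψ n) i := by linarith [hobj (ψ n)]
    refine (mul_le_mul_of_nonneg_left h2 (hc0 n)).trans_eq ?_
    rw [mul_neg, Finset.mul_sum]
    exact congrArg _ (Finset.sum_congr rfl fun i _ => by ring)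
  -- Stationarity of the Lagrangian along `z`, split into its terms by uniqueness of the limit of
  -- difference quotients.
  have hstat : fderiv ℝ (ℓ 0) θ z + ∑ i : Fin m, lam i * fderiv ℝ (ℓ i.succ) θ z = 0 := by
    have h1 := hfirst (lagrangian_contDiffAt hs lam hθ)
    rw [hkkt.fderiv_lagrangian] at h1
    refine tendsto_nhds_unique ?_ h1
    refine ((hfirst (hs 0 θ hθ)).add (tendsto_finsetSum Finset.univ fun (i : Fin m) _ =>
      (hfirst (hs i.succ θ hθ)).const_mul (lam i))).congr fun n => ?_
    simp only [lagrangian, mul_sub, mul_add, Finset.mul_sum, Finset.sum_sub_distrib,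
      mul_left_comm (c n)]
    ring
  have hterm : ∀ i : Fin m, lam i * fderiv ℝ (ℓ i.succ) θ z ≤ 0 := by
    intro i
    rcases mul_eq_zero.1 (hkkt.2.2.1 i) with h | h
    · simp [h]
    · exact mul_nonpos_of_nonneg_of_nonpos (hlam i) (hact i h)
  -- By `hstat` and `hdesc` these nonpositive terms have a nonnegative sum, so each vanishes.
  have hzero : ∀ i : Fin m, lam i * fderiv ℝ (ℓ i.succ) θ z = 0 := by
    have h := (Finset.sum_eq_zero_iff_of_nonpos
      (f := fun i : Fin m => lam i * fderiv ℝ (ℓ i.succ) θ z) fun i _ => hterm i).1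
      (le_antisymm (Finset.sum_nonpos fun i _ => hterm i) (by linarith))
    exact fun i => h i (Finset.mem_univ i)
  have hcone : z ∈ criticalCone ℓ θ lam := by
    intro i hi
    rw [inner_gradient_left]
    exact ⟨fun h => (mul_eq_zero.1 (hzero i)).resolve_left h.ne', fun _ => hact i hi⟩
  exact (hpos z hcone hz0).not_ge hcurv

/-- The second-order multiplier with a large enough penalty is dual optimal. If every penalty `k +
1` failed, the offending points would accumulate at a solution, possibly different from `θ₀`; this
is why one multiplier must serve all solutions. -/
lemma exists_isDualSolution {ℓ : Fin (m + 1) → Param p → ℝ} {Θ : Set (Param p)}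
    (hbdd : BddBelow (ℓ 0 '' Θ)) (hK : CompactLevelSet ℓ Θ) (hs : SmoothProgram ℓ Θ)
    (hsosc : SOSC ℓ Θ) : ∃ (lam : Fin m → ℝ) (α : ℝ), IsDualSolution ℓ Θ lam α := by
  have hℓ : ∀ i, ContinuousOn (ℓ i) Θ := fun i θ hθ =>
    (hs i θ hθ).continuousAt.continuousWithinAt
  obtain ⟨θ₀, h₀⟩ := exists_isPrimalSolution hℓ hK
  obtain ⟨lam, hlam⟩ := hsosc
  by_contra! hno
  have hex : ∀ k : ℕ, ∃ η ∈ Θ, augLagrangian ℓ η lam ((k : ℝ) + 1) < ℓ 0 θ₀ := by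
    intro k
    by_contra! h
    exact hno lam _ (isDualSolution_of_le h₀ (by positivity) h)
  choose η hη hlt using hex
  obtain ⟨θ, hθ, hle, φ, hφ, hlim⟩ := exists_tendsto_feasible hℓ hbdd hK (hlam θ₀ h₀).1.2.1
    h₀.primalValue_eq.ge hη fun k => (hlt k).le
  have hsol : IsPrimalSolution ℓ Θ θ := ⟨hθ, fun θ' h' => hle.trans (h₀.2 θ' h')⟩
  refine false_of_tendsto_of_augLagrangian_lt hs (hlam θ hsol).1 (hlam θ hsol).2
    (α := fun n => (φ n : ℝ) + 1) (fun n => by positivity)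
    (tendsto_atTop_add_const_right _ _ (tendsto_natCast_atTop_atTop.comp hφ.tendsto_atTop)) hlim
    fun n => (hlt (φ n)).trans_le (h₀.2 θ hθ)

/-! ### Comparison of two uniformly close programs -/

/-- The optimal values and solutions of two programs whose functions differ by at most `ζ` on
`Θ`. -/
lemma abs_sub_le_of_uniformly_close {ℓ ℓ' : Fin (m + 1) → Param p → ℝ} {Θ : Set (Param p)}
    {ζ α α' : ℝ} (hζ : 0 ≤ ζ) (hclose : ∀ i, ∀ θ ∈ Θ, |ℓ i θ - ℓ' i θ| ≤ ζ)
    {θ θ' : Param p} {lam lam' : Fin m → ℝ}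
    (hθ : θ ∈ feasibleSet ℓ Θ) (hθ' : θ' ∈ feasibleSet ℓ' Θ) (hα : 0 < α) (hα' : 0 < α')
    (hdual : ∀ η ∈ Θ, ℓ 0 θ ≤ augLagrangian ℓ η lam α)
    (hdual' : ∀ η ∈ Θ, ℓ' 0 θ' ≤ augLagrangian ℓ' η lam' α') :
    |ℓ 0 θ - ℓ 0 θ'| ≤
      (2 + max (l1Norm lam) (l1Norm lam')) * ζ + max α α' * m * ζ ^ 2 := by
  -- Feasibility for one program is violation at most `ζ` in the other. `h1` bounds `ℓ 0 θ - ℓ 0 θ'`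
  -- directly; `h2` compares the objectives `ℓ' 0`, and passing to `ℓ 0` at both points costs the `2
  -- * ζ`.
  have h1 := (hdual θ' hθ'.1).trans (augLagrangian_le lam hα hζ fun i => by
    linarith [hθ'.2 i, abs_le.1 (hclose i.succ θ' hθ'.1)])
  have h2 := (hdual' θ hθ.1).trans (augLagrangian_le lam' hα' hζ fun i => by
    linarith [hθ.2 i, abs_le.1 (hclose i.succ θ hθ.1)])
  have h3 := abs_le.1 (hclose 0 θ hθ.1)
  have h4 := abs_le.1 (hclose 0 θ' hθ'.1)
  have h5 : l1Norm lam * ζ ≤ max (l1Norm lam) (l1Norm lam') * ζ := by gcongr; exact le_max_left _ _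
  have h6 : l1Norm lam' * ζ ≤ max (l1Norm lam) (l1Norm lam') * ζ := by
    gcongr; exact le_max_right _ _
  have h7 : α * m * ζ ^ 2 ≤ max α α' * m * ζ ^ 2 := by gcongr; exact le_max_left _ _
  have h8 : α' * m * ζ ^ 2 ≤ max α α' * m * ζ ^ 2 := by gcongr; exact le_max_right _ _
  rw [abs_le]
  constructor <;> linarith

/-! ### Empirical risks and sample laws -/

variable {X Y : Type*}

lemma empRisk_continuousOn [TopologicalSpace Y] {f : Param p → X → Y}
    {loss : Fin (m + 1) → Y → Y → ℝ} {Θ : Set (Param p)} (h : ContinuityAssumption f loss Θ)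
    {N : Fin (m + 1) → ℕ} (S : Sample X Y N) (i : Fin (m + 1)) :
    ContinuousOn (empRisk f loss S i) Θ :=
  continuousOn_const.mul (continuousOn_finsetSum _ fun _ _ =>
    (h.2.1 i _).comp_continuousOn (h.1 _))

lemma empRisk_bddBelow [TopologicalSpace Y] {f : Param p → X → Y}
    {loss : Fin (m + 1) → Y → Y → ℝ} {Θ : Set (Param p)} (h : ContinuityAssumption f loss Θ)
    {N : Fin (m + 1) → ℕ} (S : Sample X Y N) (i : Fin (m + 1)) :
    BddBelow (empRisk f loss S i '' Θ) := by
  obtain ⟨C, hC⟩ := h.2.2 i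
  refine ⟨1 / (N i : ℝ) * ∑ _k : Fin (N i), -C, ?_⟩
  rintro _ ⟨θ, -, rfl⟩
  unfold empRisk sampleMean
  gcongr
  exact (abs_le.1 (hC _ _)).1

variable [MeasurableSpace X] [MeasurableSpace Y]

lemma IsSampleLaw.isProbabilityMeasure {D : Fin (m + 1) → Measure (X × Y)}
    [∀ i, IsProbabilityMeasure (D i)] {N : Fin (m + 1) → ℕ} {μ : Measure (Sample X Y N)}
    (h : IsSampleLaw D N μ) : IsProbabilityMeasure μ := by
  constructor
  -- A pushforward preserves total mass, so one marginal suffices; index `0` always exists.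
  have h0 := h 0
  have : (μ.map fun S => S 0) Set.univ = 1 := by rw [h0]; exact measure_univ
  rwa [Measure.map_apply (measurable_pi_apply 0) MeasurableSet.univ, Set.preimage_univ] at this

lemma HoldsWithProb.mono {Ω : Type*} [MeasurableSpace Ω] {μ : Measure Ω} {P Q : Ω → Prop} {q r : ℝ}
    (h : HoldsWithProb μ P q) (hPQ : ∀ ω, P ω → Q ω) (hr : r ≤ q) : HoldsWithProb μ Q r := by
  obtain ⟨A, hA, hP, hq⟩ := h
  exact ⟨A, hA, fun ω hω => hPQ ω (hP ω hω), (ENNReal.ofReal_le_ofReal hr).trans hq⟩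

/-- Union bound. -/
lemma HoldsWithProb.iForall {Ω ι : Type*} [Fintype ι] [MeasurableSpace Ω] {μ : Measure Ω}
    [IsProbabilityMeasure μ] {P : ι → Ω → Prop} {δ : ι → ℝ}
    (h : ∀ i, HoldsWithProb μ (P i) (1 - δ i)) :
    HoldsWithProb μ (fun ω => ∀ i, P i ω) (1 - ∑ i, δ i) := by
  choose A hA hP hq using h
  refine ⟨⋂ i, A i, MeasurableSet.iInter hA, fun ω hω i => hP i ω (Set.mem_iInter.1 hω i), ?_⟩
  have hcompl : ∀ i, μ.real (A i)ᶜ ≤ δ i := by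
    intro i
    have h1 : 1 - δ i ≤ μ.real (A i) :=
      (ENNReal.ofReal_le_iff_le_toReal (measure_ne_top _ _)).1 (hq i)
    rw [probReal_compl_eq_one_sub (hA i)]
    linarith
  have hunion : μ.real (⋂ i, A i)ᶜ ≤ ∑ i, δ i := by
    rw [Set.compl_iInter]
    exact (measureReal_iUnion_fintype_le _).trans (Finset.sum_le_sum fun i _ => hcompl i)
  rw [probReal_compl_eq_one_sub (MeasurableSet.iInter hA)] at hunion
  exact (ENNReal.ofReal_le_iff_le_toReal (measure_ne_top _ _)).2
    (by change 1 - ∑ i, δ i ≤ μ.real _; linarith)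

lemma HoldsWithProb.and {Ω : Type*} [MeasurableSpace Ω] {μ : Measure Ω} [IsProbabilityMeasure μ]
    {P Q : Ω → Prop} {δ δ' : ℝ} (hP : HoldsWithProb μ P (1 - δ)) (hQ : HoldsWithProb μ Q (1 - δ')) :
    HoldsWithProb μ (fun ω => P ω ∧ Q ω) (1 - (δ + δ')) := by
  have h := HoldsWithProb.iForall (μ := μ) (P := fun b : Bool => bif b then P else Q)
    (δ := fun b => bif b then δ else δ') (by rintro (_ | _) <;> simpa)
  exact h.mono (fun ω hω => ⟨hω true, hω false⟩) (by simp)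

/-- Simultaneous uniform convergence of all the empirical risks. -/
lemma UniformConvergence.holdsWithProb {f : Param p → X → Y} {loss : Fin (m + 1) → Y → Y → ℝ}
    {D : Fin (m + 1) → Measure (X × Y)} [∀ i, IsProbabilityMeasure (D i)] {Θ : Set (Param p)}
    {ζ : Fin (m + 1) → ℕ → ℝ → ℝ} (h : UniformConvergence f loss D Θ ζ) {N : Fin (m + 1) → ℕ}
    (hN : ∀ i, 0 < N i) {δ : ℝ} (hδ : 0 < δ) (hδ' : δ < 1) {μ : Measure (Sample X Y N)}
    (hμ : IsSampleLaw D N μ) :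
    HoldsWithProb μ (fun S => ∀ i, ∀ θ ∈ Θ,
      |risk f loss D i θ - empRisk f loss S i θ| ≤ ζ i (N i) δ) (1 - ((m : ℝ) + 1) * δ) := by
  have := hμ.isProbabilityMeasure
  have h1 : ∀ i, HoldsWithProb μ (fun S => ∀ θ ∈ Θ,
      |risk f loss D i θ - empRisk f loss S i θ| ≤ ζ i (N i) δ) (1 - δ) := by
    intro i
    obtain ⟨A, hA, hP, hq⟩ := (h i δ hδ hδ').2.2 (N i) (hN i)
    refine ⟨(fun S : Sample X Y N => S i) ⁻¹' A, measurable_pi_apply i hA,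
      fun S hS => hP (S i) hS, ?_⟩
    rwa [← Measure.map_apply (measurable_pi_apply i) hA, hμ i]
  exact (HoldsWithProb.iForall h1).mono (fun _ hS => hS) (by simp)

/-- Near optimality and near feasibility of a solution of the empirical problem on a data set with
uniformly accurate empirical risks. -/
lemma near_optimal_of_uniformly_close [TopologicalSpace Y] {f : Param p → X → Y}
    {loss : Fin (m + 1) → Y → Y → ℝ} {D : Fin (m + 1) → Measure (X × Y)} {Θ : Set (Param p)}
    (hℓ : ∀ i, ContinuousOn (risk f loss D i) Θ) (hbdd : BddBelow (risk f loss D 0 '' Θ))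
    (hK : CompactLevelSet (risk f loss D) Θ) (hcont : ContinuityAssumption f loss Θ)
    {θ : Param p} (hθ : IsPrimalSolution (risk f loss D) Θ θ) {N : Fin (m + 1) → ℕ}
    {S : Sample X Y N} {z : Fin (m + 1) → ℝ} (hz : ∀ i, 0 ≤ z i)
    (hclose : ∀ i, ∀ η ∈ Θ, |risk f loss D i η - empRisk f loss S i η| ≤ z i)
    (hKS : CompactLevelSet (empRisk f loss S) Θ) {lam lam' : Fin m → ℝ} {α α' : ℝ}
    {θ' : Param p} (hd' : IsDualSolution (empRisk f loss S) Θ lam' α')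
    (hθ' : IsPrimalSolution (empRisk f loss S) Θ θ')
    (hd : IsDualSolution (risk f loss D) Θ lam α) :
    |risk f loss D 0 θ - risk f loss D 0 θ'| ≤
        (2 + max (l1Norm lam) (l1Norm lam')) * (⨆ i, z i) + max α α' * m * (⨆ i, z i) ^ 2 ∧
      ∀ i : Fin m, risk f loss D i.succ θ' ≤ z i.succ := by
  have hle : ∀ i, z i ≤ ⨆ i, z i := fun i => le_ciSup (Set.finite_range z).bddAbove i
  refine ⟨abs_sub_le_of_uniformly_close ((hz 0).trans (hle 0))
    (fun i η hη => (hclose i η hη).trans (hle i)) hθ.1 hθ'.1 hd.1 hd'.1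
    (fun η hη => hd.le_augLagrangian hℓ hbdd hK hθ hη)
    (fun η hη => hd'.le_augLagrangian (empRisk_continuousOn hcont S)
      (empRisk_bddBelow hcont S 0) hKS hθ' hη), fun i => ?_⟩
  linarith [hθ'.1.2 i, abs_le.1 (hclose i.succ θ' hθ'.1.1)]

/-- The bound `B` on the empirical dual solutions makes the error at most a fixed polynomial in the
largest rate, vanishing at `0`. No residual constant survives as the rates tend to `0`. -/
lemma SolvesEmpiricalProblem.isPACCLearner [TopologicalSpace Y] {f : Param p → X → Y}
    {loss : Fin (m + 1) → Y → Y → ℝ} {D : Fin (m + 1) → Measure (X × Y)}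
    [∀ i, IsProbabilityMeasure (D i)] {Θ : Set (Param p)} {ζ : Fin (m + 1) → ℕ → ℝ → ℝ}
    (hℓ : ∀ i, ContinuousOn (risk f loss D i) Θ) (hbdd : BddBelow (risk f loss D 0 '' Θ))
    (hK : CompactLevelSet (risk f loss D) Θ) (hcont : ContinuityAssumption f loss Θ)
    (hunif : UniformConvergence f loss D Θ ζ)
    {θ : Param p} (hθ : IsPrimalSolution (risk f loss D) Θ θ) {lam : Fin m → ℝ} {α : ℝ}
    (hd : IsDualSolution (risk f loss D) Θ lam α)
    (hζ : ∀ i, ∀ δ : ℝ, 0 < δ → δ < 1 → Tendsto (fun n => ζ i n δ) atTop (𝓝 0))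
    {A : (N : Fin (m + 1) → ℕ) → Sample X Y N → Param p}
    (hA : SolvesEmpiricalProblem f loss D Θ A) :
    IsPACCLearner f loss D Θ (risk f loss D 0 θ) A := by
  intro ε δ hε hδ hδ'
  obtain ⟨B, N₁, hB⟩ := hA (δ / 2) (by linarith) (by linarith)
  -- Half of `δ` covers failure of the learner's hypothesis; the other half is shared by the `m + 1`
  -- uniform convergence events.
  set δ₁ : ℝ := δ / 2 / (m + 1) with hδ₁def
  have hm : (0 : ℝ) < (m : ℝ) + 1 := by positivity
  have hδ₁ : 0 < δ₁ := by positivity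
  have hδ₁' : δ₁ < 1 := by
    rw [hδ₁def, div_lt_one hm]
    linarith [m.cast_nonneg (α := ℝ)]
  have hbound : Tendsto (fun t : ℝ => (2 + max (l1Norm lam) B) * t + max α B * m * t ^ 2)
      (𝓝 0) (𝓝 0) := by
    have : Continuous fun t : ℝ => (2 + max (l1Norm lam) B) * t + max α B * m * t ^ 2 := by
      fun_prop
    simpa using this.tendsto 0
  obtain ⟨r, hr, hball⟩ := Metric.eventually_nhds_iff.1 (hbound.eventually_lt_const hε)
  have hsmall : ∀ᶠ n in atTop, ∀ i, ζ i n δ₁ < min r ε :=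
    eventually_all.2 fun i => (hζ i δ₁ hδ₁ hδ₁').eventually_lt_const (lt_min hr hε)
  obtain ⟨N₂, hN₂⟩ := eventually_atTop.1 hsmall
  refine ⟨max (max N₁ N₂) 1, fun N hN μ hμ => ?_⟩
  have hN1 : ∀ i, N₁ ≤ N i := fun i => ((le_max_left _ _).trans (le_max_left _ _)).trans (hN i)
  have hN2 : ∀ i, N₂ ≤ N i := fun i => ((le_max_right _ _).trans (le_max_left _ _)).trans (hN i)
  have hN0 : ∀ i, 0 < N i := fun i => (le_max_right _ _).trans (hN i)
  have := hμ.isProbabilityMeasure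
  have hz0 : ∀ i, 0 ≤ ζ i (N i) δ₁ := fun i => (hunif i δ₁ hδ₁ hδ₁').1 _ (hN0 i)
  have hzlt : ∀ i, ζ i (N i) δ₁ < min r ε := fun i => hN₂ _ (hN2 i) i
  refine ((hB N hN1 μ hμ).and (hunif.holdsWithProb hN0 hδ₁ hδ₁' hμ)).mono ?_ ?_
  · rintro S ⟨⟨hKS, hsol, lam', α', hd', hlam', hα'⟩, hclose⟩
    obtain ⟨h1, h2⟩ := near_optimal_of_uniformly_close hℓ hbdd hK hcont hθ hz0 hclose hKS hd' hsol
      hd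
    refine ⟨hsol.1.1, ?_, fun i => (h2 i).trans ((hzlt i.succ).le.trans (min_le_right _ _))⟩
    -- The supremum over the finitely many rates is one of them, hence below `r`.
    obtain ⟨i₀, hi₀⟩ := exists_eq_ciSup_of_finite (f := fun i => ζ i (N i) δ₁)
    rw [← hi₀] at h1
    refine h1.trans (le_trans ?_ (hball (y := ζ i₀ (N i₀) δ₁) ?_).le)
    · have := hz0 i₀
      gcongr
    · rw [Real.dist_eq, sub_zero, abs_of_nonneg (hz0 i₀)]
      exact (hzlt i₀).trans_le (min_le_left _ _)
  · have : ((m : ℝ) + 1) * δ₁ = δ / 2 := by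
      rw [hδ₁def]; field_simp
    linarith

end PACC

theorem theorem3 {p m : ℕ} {X Y : Type*} [MeasurableSpace X] [MeasurableSpace Y]
    [TopologicalSpace Y]
    (f : PACC.Param p → X → Y) (loss : Fin (m + 1) → Y → Y → ℝ)
    (D : Fin (m + 1) → Measure (X × Y)) [∀ i, IsProbabilityMeasure (D i)]
    (Θ : Set (PACC.Param p)) (ζ : Fin (m + 1) → ℕ → ℝ → ℝ)
    (hmeas : ∀ i, ∀ θ ∈ Θ, Measurable (fun z : X × Y => loss i (f θ z.1) z.2))
    (hbdd : BddBelow (PACC.risk f loss D 0 '' Θ))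
    (hclosed : IsClosed Θ)
    (hcont : PACC.ContinuityAssumption f loss Θ)
    (hcompact : PACC.CompactLevelSet (PACC.risk f loss D) Θ)
    (hlicq : PACC.LICQ (PACC.risk f loss D) Θ)
    (hsmooth : PACC.SmoothProgram (PACC.risk f loss D) Θ)
    (hsosc : PACC.SOSC (PACC.risk f loss D) Θ)
    (hunif : PACC.UniformConvergence f loss D Θ ζ) :
    -- the optimal value is finite and attained, and the augmented dual has a solution
    ∃ Pstar : ℝ, PACC.primalValue (PACC.risk f loss D) Θ = (Pstar : EReal) ∧
      (∃ θ, PACC.IsPrimalSolution (PACC.risk f loss D) Θ θ) ∧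
      (∃ (lam : Fin m → ℝ) (α : ℝ), PACC.IsDualSolution (PACC.risk f loss D) Θ lam α) ∧
      -- so does the empirical problem on every data set on which it is as regular
      (∀ (N : Fin (m + 1) → ℕ) (S : PACC.Sample X Y N),
        PACC.CompactLevelSet (PACC.empRisk f loss S) Θ →
        PACC.LICQ (PACC.empRisk f loss S) Θ →
        PACC.SmoothProgram (PACC.empRisk f loss S) Θ →
        PACC.SOSC (PACC.empRisk f loss S) Θ →
        (∃ θ, PACC.IsPrimalSolution (PACC.empRisk f loss S) Θ θ) ∧
        ∃ (lam : Fin m → ℝ) (α : ℝ), PACC.IsDualSolution (PACC.empRisk f loss S) Θ lam α) ∧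
      -- empirical solutions minimize the empirical augmented Lagrangian at a dual optimum
      (∀ (N : Fin (m + 1) → ℕ) (S : PACC.Sample X Y N),
        PACC.CompactLevelSet (PACC.empRisk f loss S) Θ →
        ∀ (lamHat : Fin m → ℝ) (αHat : ℝ) (θHat : PACC.Param p),
          PACC.IsDualSolution (PACC.empRisk f loss S) Θ lamHat αHat →
          PACC.IsPrimalSolution (PACC.empRisk f loss S) Θ θHat →
          θHat ∈ Θ ∧
          IsMinOn (fun θ => PACC.augLagrangian (PACC.empRisk f loss S) θ lamHat αHat) Θ θHat) ∧
      -- near optimality and near feasibility with probability at least `1 - (2m + 1) δ`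
      (∀ (N : Fin (m + 1) → ℕ), (∀ i, 0 < N i) → ∀ δ : ℝ, 0 < δ → δ < 1 →
        ∀ μ : Measure (PACC.Sample X Y N), PACC.IsSampleLaw D N μ →
        PACC.HoldsWithProb μ
          (fun S => PACC.CompactLevelSet (PACC.empRisk f loss S) Θ →
            ∀ (lamHat : Fin m → ℝ) (αHat : ℝ) (θHat : PACC.Param p)
              (lamStar : Fin m → ℝ) (αStar : ℝ),
              PACC.IsDualSolution (PACC.empRisk f loss S) Θ lamHat αHat →
              PACC.IsPrimalSolution (PACC.empRisk f loss S) Θ θHat →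
              PACC.IsDualSolution (PACC.risk f loss D) Θ lamStar αStar →
              |Pstar - PACC.risk f loss D 0 θHat| ≤
                (2 + max (PACC.l1Norm lamStar) (PACC.l1Norm lamHat)) * (⨆ i, ζ i (N i) δ) +
                  max αStar αHat * (m : ℝ) * (⨆ i, ζ i (N i) δ) ^ 2 ∧
              ∀ i : Fin m, PACC.risk f loss D i.succ θHat ≤ ζ i.succ (N i.succ) δ)
          (1 - (2 * (m : ℝ) + 1) * δ)) ∧
      -- if the rates vanish, solving the empirical problem is a PACC learner
      ((∀ i, ∀ δ : ℝ, 0 < δ → δ < 1 → Tendsto (fun n => ζ i n δ) atTop (𝓝 0)) →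
        ∀ A : (N : Fin (m + 1) → ℕ) → PACC.Sample X Y N → PACC.Param p,
          PACC.SolvesEmpiricalProblem f loss D Θ A →
          PACC.IsPACCLearner f loss D Θ Pstar A) := by
  have hℓ : ∀ i, ContinuousOn (PACC.risk f loss D i) Θ := fun i θ hθ =>
    (hsmooth i θ hθ).continuousAt.continuousWithinAt
  obtain ⟨θ, hθ⟩ := PACC.exists_isPrimalSolution hℓ hcompact
  obtain ⟨lam, α, hd⟩ := PACC.exists_isDualSolution hbdd hcompact hsmooth hsosc
  refine ⟨PACC.risk f loss D 0 θ, hθ.primalValue_eq, ⟨θ, hθ⟩, ⟨lam, α, hd⟩, ?_, ?_, ?_, ?_⟩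
  · intro N S hK _ hS hsoscS
    exact ⟨PACC.exists_isPrimalSolution (PACC.empRisk_continuousOn hcont S) hK,
      PACC.exists_isDualSolution (PACC.empRisk_bddBelow hcont S 0) hK hS hsoscS⟩
  · intro N S hK lamHat αHat θHat hdHat hpHat
    exact ⟨hpHat.1.1, fun η hη =>
      (PACC.augLagrangian_le_of_mem_feasibleSet hpHat.1 lamHat hdHat.1).trans
        (hdHat.le_augLagrangian (PACC.empRisk_continuousOn hcont S)
          (PACC.empRisk_bddBelow hcont S 0) hK hpHat hη)⟩
  · intro N hN δ hδ hδ' μ hμ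
    refine (hunif.holdsWithProb hN hδ hδ' hμ).mono ?_ ?_
    · intro S hclose hKS lamHat αHat θHat lamStar αStar hdHat hpHat hdStar
      exact PACC.near_optimal_of_uniformly_close hℓ hbdd hcompact hcont hθ
        (fun i => (hunif i δ hδ hδ').1 _ (hN i)) hclose hKS hdHat hpHat hdStar
    -- The union bound loses only `(m + 1) * δ`, which is at most `(2 * m + 1) * δ`.
    · have : (m : ℝ) * δ ≥ 0 := by positivity
      linarith
  · intro hζ A hA
    exact hA.isPACCLearner hℓ hbdd hcompact hcont hunif hθ hd hζ
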